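/- A multi-hypergraph is a finite hypergraph in which a hyperedge may occur several times; copies of the same vertex set count as distinct hyperedges, and hyperedges are counted with multiplicity. A Berge cycle of length $t$ consists of distinct vertices $v_0,\dots,v_{t-1}$ and distinct hyperedges $e_1,\dots,e_t$ with $v_{i-1},v_i\in e_i$ for $1\le i\le t$ (indices of the vertices modulo $t$). The 2-shadow of $\mathcal H$ is the graph on $V(\mathcal H)$ in which two distinct vertices are adjacent when some hyperedge contains both. A block of a graph is an inclusion-maximal set of at least two vertices that induces a connected subgraph without a cut vertex (so a bridge forms a block). An $r$-uniform multi-hypergraph is an $(r,k-1)$-block tree if its 2-shadow is connected and every block of its 2-shadow consists of $r$ vertices and contains exactly $k-1$ hyperedges; in particular, a single vertex without hyperedges is a block tree. Theorem. Let $k,n,r$ be positive integers with $2\le k\le r$. The maximum number of hyperedges of an $r$-uniform multi-hypergraph on $n$ vertices that contains no Berge cycle of length at least $k$ is $$\left\lfloor\frac{n-1}{r-1}\right\rfloor (k-1).$$ If $(r-1)\mid(n-1)$, then an $r$-uniform multi-hypergraph on $n$ vertices contains no Berge cycle of length at least $k$ and attains this maximum if and only if it is an $(r,k-1)$-block tree.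 -/

import Mathlib

/-- A multi-hypergraph with vertex set `V` and hyperedges labelled by `E`: every label `e : E` is
one hyperedge, with vertex set `edge e`. Distinct labels may carry the same vertex set, so the
multiplicity of a set `h` is the number of labels `e` with `edge e = h`, and the number of
hyperedges, counted with multiplicity, is the cardinality of `E`. -/
structure MultiHypergraph (V : Type*) (E : Type*) where
  edge : E → Finset V

namespace MultiHypergraph

/-- Every hyperedge has exactly `r` vertices. -/
def IsUniform {V E : Type*} (H : MultiHypergraph V E) (r : ℕ) : Prop :=
  ∀ e : E, (H.edge e).card = r

/-- `H` has a Berge cycle of length `t`: distinct vertices `v 0, …, v (t - 1)` and distinct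
hyperedges `e 0, …, e (t - 1)` such that `e i` contains `v i` and the cyclically next vertex
(`finRotate t` is the map `i ↦ i + 1` modulo `t`). Copies of the same set count as distinct
hyperedges. -/
def HasBergeCycle {V E : Type*} (H : MultiHypergraph V E) (t : ℕ) : Prop :=
  ∃ (v : Fin t → V) (e : Fin t → E), Function.Injective v ∧ Function.Injective e ∧
    ∀ i : Fin t, v i ∈ H.edge (e i) ∧ v (finRotate t i) ∈ H.edge (e i)

/-- `H` contains no Berge cycle of length at least `k`. -/
def BergeCycleFree {V E : Type*} (H : MultiHypergraph V E) (k : ℕ) : Prop :=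
  ∀ t : ℕ, k ≤ t → ¬ H.HasBergeCycle t

/-- The 2-shadow: two distinct vertices are adjacent when some hyperedge contains both. -/
def shadow {V E : Type*} (H : MultiHypergraph V E) : SimpleGraph V where
  Adj u v := u ≠ v ∧ ∃ e : E, u ∈ H.edge e ∧ v ∈ H.edge e
  symm := ⟨fun _ _ h => ⟨h.1.symm, h.2.imp fun _ he => ⟨he.2, he.1⟩⟩⟩
  loopless := ⟨fun _ h => h.1 rfl⟩

/-- The numbers of hyperedges of the finite `r`-uniform multi-hypergraphs on the vertex set `V`
that have no Berge cycle of length at least `k`. -/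
def bergeCycleFreeSizes (V : Type*) (r k : ℕ) : Set ℕ :=
  {m | ∃ H : MultiHypergraph V (Fin m), H.IsUniform r ∧ H.BergeCycleFree k}

/-- `H` is extremal: it is `r`-uniform, has no Berge cycle of length at least `k`, and no such
multi-hypergraph on the same vertex set has more hyperedges. -/
def IsExtremal {V E : Type*} [Fintype E] (H : MultiHypergraph V E) (r k : ℕ) : Prop :=
  H.IsUniform r ∧ H.BergeCycleFree k ∧ ∀ m ∈ bergeCycleFreeSizes V r k, m ≤ Fintype.card E

end MultiHypergraph

/-- `B` is the vertex set of a block of `G`: an inclusion-maximal set of at least two vertices that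
induces a connected subgraph without a cut vertex. A bridge is a block with two vertices; an
isolated vertex is not a block. -/
def SimpleGraph.IsBlockSet {V : Type*} (G : SimpleGraph V) (B : Set V) : Prop :=
  Maximal (fun S : Set V => S.Nontrivial ∧ (G.induce S).Connected ∧
    ∀ v ∈ S, (G.induce (S \ {v})).Connected) B

/-- `H` is an `r`-uniform `(s, q)`-block tree: its 2-shadow is connected, and every block of the
2-shadow has `s` vertices and induces (contains) exactly `q` hyperedges of `H`, counted with
multiplicity. -/
def MultiHypergraph.IsBlockTree {V E : Type*} (H : MultiHypergraph V E) (r s q : ℕ) : Prop :=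
  H.IsUniform r ∧ H.shadow.Connected ∧
    ∀ B : Set V, H.shadow.IsBlockSet B →
      B.ncard = s ∧ {e : E | (H.edge e : Set V) ⊆ B}.ncard = q

/-! The upper bound comes from peeling. By `exists_sparse_set`, some `r - 1` vertices meet at most
`k - 1` hyperedges; deleting these vertices and hyperedges lowers the bound by exactly `k - 1`, and
fewer than `r` vertices carry no hyperedge.

The sparse set is read off a longest semi-path. A vertex off the path in its first hyperedge meets
only the first `k - 1` path hyperedges: any other hyperedge would extend the path or close a long
cycle. Rotations (`IsSemiPath.rotate`, `IsSemiPath.rotate_through`) bring other hyperedges to the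
front and free other vertices, which supplies enough such vertices.

When `r - 1` divides `n - 1`, equality forces every peeling step to remove exactly `k - 1`
hyperedges. Inductively, any two remaining vertices are joined by a Berge path with at least `k - 1`
hyperedges, so a removed hyperedge meeting the rest twice would close a long cycle. Hence the
removed hyperedges are parallel and hang on one vertex (`IsTreeLike.exists_edge_eq_insert`), and
`IsTreeLike.glue` attaches them as a new block.

Conversely, a Berge cycle lies in one block, so it has at most `k - 1` hyperedges; connectedness of
the shadow forces enough blocks to reach the bound. -/

namespace MultiHypergraph

/-! ### Semi-paths and their rotations -/

variable {V E : Type*} {H : MultiHypergraph V E}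

/-- A semi-path of `t` hyperedges from `F`: an alternating sequence
`e 0, v 0, e 1, v 1, …, e (t - 1), v (t - 1)` of distinct hyperedges and distinct vertices
in which consecutive members are incident. -/
structure IsSemiPath (H : MultiHypergraph V E) (F : Finset E) (e : ℕ → E) (v : ℕ → V)
    (t : ℕ) : Prop where
  mem : ∀ j < t, e j ∈ F
  inj_edge : ∀ i < t, ∀ j < t, e i = e j → i = j
  inj_vert : ∀ i < t, ∀ j < t, v i = v j → i = j
  left : ∀ j < t, v j ∈ H.edge (e j)
  right : ∀ j, j + 1 < t → v j ∈ H.edge (e (j + 1))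

/-- The sequence `a` followed by the terms of `s`. -/
def seqCons {α : Type*} (a : α) (s : ℕ → α) : ℕ → α
  | 0 => a
  | j + 1 => s j

namespace IsSemiPath

variable {F : Finset E} {e : ℕ → E} {v : ℕ → V} {t : ℕ}

theorem mono {F' : Finset E} (h : H.IsSemiPath F e v t) (hF : F ⊆ F') :
    H.IsSemiPath F' e v t :=
  ⟨fun j hj => hF (h.mem j hj), h.inj_edge, h.inj_vert, h.left, h.right⟩

theorem take {s : ℕ} (h : H.IsSemiPath F e v t) (hs : s ≤ t) : H.IsSemiPath F e v s :=
  ⟨fun j hj => h.mem j (by omega), fun i hi j hj => h.inj_edge i (by omega) j (by omega),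
    fun i hi j hj => h.inj_vert i (by omega) j (by omega), fun j hj => h.left j (by omega),
    fun j hj => h.right j (by omega)⟩

theorem cons (h : H.IsSemiPath F e v t) {g : E} {x : V} (hg : g ∈ F)
    (hge : ∀ j < t, e j ≠ g) (hxv : ∀ j < t, v j ≠ x) (hxg : x ∈ H.edge g)
    (hx : 0 < t → x ∈ H.edge (e 0)) :
    H.IsSemiPath F (seqCons g e) (seqCons x v) (t + 1) := by
  refine ⟨?_, ?_, ?_, ?_, ?_⟩
  · rintro (_ | j) hj
    · exact hg
    · exact h.mem j (by omega)
  · rintro (_ | i) hi (_ | j) hj hij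
    · rfl
    · exact absurd hij.symm (hge j (by omega))
    · exact absurd hij (hge i (by omega))
    · rw [h.inj_edge i (by omega) j (by omega) hij]
  · rintro (_ | i) hi (_ | j) hj hij
    · rfl
    · exact absurd hij.symm (hxv j (by omega))
    · exact absurd hij (hxv i (by omega))
    · rw [h.inj_vert i (by omega) j (by omega) hij]
  · rintro (_ | j) hj
    · exact hxg
    · exact h.left j (by omega)
  · rintro (_ | j) hj
    · exact hx (by omega)
    · exact h.right j (by omega)

/-- A semi-path whose last vertex lies in its first hyperedge closes up to a Berge cycle. -/
theorem hasBergeCycle (h : H.IsSemiPath F e v (t + 1)) (hc : v t ∈ H.edge (e 0)) :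
    H.HasBergeCycle (t + 1) := by
  -- The hyperedge through `v i` and its successor is `e (i + 1)`; at the last index it wraps to `e
  -- 0`.
  refine ⟨fun i => v i, fun i => e (finRotate (t + 1) i), ?_, ?_, ?_⟩
  · intro i j hij
    exact Fin.ext (h.inj_vert i i.2 j j.2 hij)
  · intro i j hij
    exact (finRotate (t + 1)).injective
      (Fin.ext (h.inj_edge _ (Fin.is_lt _) _ (Fin.is_lt _) hij))
  · intro i
    refine ⟨?_, h.left _ (Fin.is_lt _)⟩
    rcases Fin.eq_castSucc_or_eq_last i with ⟨j, rfl⟩ | rfl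
    · have hj := j.2
      simpa [finRotate_apply, Fin.coeSucc_eq_succ] using h.right j (by omega)
    · simpa [finRotate_apply] using hc

theorem lt_of_bergeCycleFree {k i : ℕ} (hfree : H.BergeCycleFree k)
    (h : H.IsSemiPath F e v t) (hi : i < t) (hc : v i ∈ H.edge (e 0)) : i + 1 < k := by
  by_contra hlt
  exact hfree (i + 1) (by omega) ((h.take (s := i + 1) (by omega)).hasBergeCycle hc)

/-- In a longest semi-path, every hyperedge at a vertex of the first hyperedge off the path is
among the first `k - 1` hyperedges of the path. -/
theorem exists_eq_edge_of_mem {k : ℕ} (hk : 2 ≤ k) (hfree : H.BergeCycleFree k)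
    (h : H.IsSemiPath F e v t)
    (hmax : ∀ e' v' t', H.IsSemiPath F e' v' t' → t' ≤ t) {w : V}
    (hw : w ∈ H.edge (e 0)) (hwv : ∀ j < t, v j ≠ w) {f : E} (hf : f ∈ F)
    (hwf : w ∈ H.edge f) : ∃ j < t, j < k - 1 ∧ f = e j := by
  by_cases hfe : ∃ j < t, e j = f
  · obtain ⟨j, hj, rfl⟩ := hfe
    refine ⟨j, hj, ?_, rfl⟩
    by_contra hjk
    -- The cycle is `e j, w, e 0, v 0, …, e (j - 1), v (j - 1)`, closed by `v (j - 1) ∈ e j`.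
    have hc := (h.take (s := j) (by omega)).cons (g := e j) (x := w) hf
      (fun i hi hij => by have := h.inj_edge i (by omega) j hj hij; omega)
      (fun i hi => hwv i (by omega)) hwf (fun _ => hw)
    refine hfree (j + 1) (by omega) (hc.hasBergeCycle ?_)
    obtain ⟨i, rfl⟩ : ∃ i, j = i + 1 := ⟨j - 1, by omega⟩
    exact h.right i (by omega)
  · push Not at hfe
    have := hmax _ _ _ (h.cons hf hfe hwv hwf fun _ => hw)
    omega

/-- If `v i` lies in the first hyperedge, the part before `v i` may be reversed. -/
theorem rotate (h : H.IsSemiPath F e v t) {i : ℕ} (hi : i < t) (hc : v i ∈ H.edge (e 0)) :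
    ∃ e' v', H.IsSemiPath F e' v' t ∧ e' 0 = e i ∧ (∀ j < t, ∃ j' < t, v' j = v j') ∧
      (∀ j, i ≤ j → v' j = v j) ∧ (∀ j, i < j → e' j = e j) ∧
      ∀ j ≤ i, ∃ j' ≤ i, e' j = e j' := by
  have he : ∀ j, (if j ≤ i then e (i - j) else e j) = e (if j ≤ i then i - j else j) := by
    intro j; split_ifs <;> rfl
  have hv : ∀ j, (if j < i then v (i - 1 - j) else v j) = v (if j < i then i - 1 - j else j) := by
    intro j; split_ifs <;> rfl
  -- The new order is `e i, v (i - 1), …, v 0, e 0, v i, e (i + 1), …`, spliced at `v i ∈ e 0`.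
  refine ⟨fun j => if j ≤ i then e (i - j) else e j,
    fun j => if j < i then v (i - 1 - j) else v j, ⟨?_, ?_, ?_, ?_, ?_⟩, ?_, ?_, ?_, ?_, ?_⟩
  · intro j hj
    simp only [he]
    exact h.mem _ (by split_ifs <;> omega)
  · intro a ha b hb hab
    simp only [he] at hab
    have := h.inj_edge _ (by split_ifs <;> omega) _ (by split_ifs <;> omega) hab
    split_ifs at this <;> omega
  · intro a ha b hb hab
    simp only [hv] at hab
    have := h.inj_vert _ (by split_ifs <;> omega) _ (by split_ifs <;> omega) hab
    split_ifs at this <;> omega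
  · intro j hj
    rcases lt_trichotomy j i with hji | rfl | hji
    · simp only [hji, hji.le, if_true]
      have := h.right (i - 1 - j) (by omega)
      rwa [show i - 1 - j + 1 = i - j by omega] at this
    · simpa using hc
    · simp only [not_lt.2 hji.le, not_le.2 hji, if_false]
      exact h.left j hj
  · intro j hj
    rcases lt_or_ge j i with hji | hji
    · simp only [hji, Nat.succ_le_of_lt hji, if_true]
      have := h.left (i - 1 - j) (by omega)
      rwa [show i - 1 - j = i - (j + 1) by omega] at this ⊢
    · simp only [not_lt.2 hji, show ¬ (j + 1 ≤ i) by omega, if_false]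
      exact h.right j hj
  · simp
  · intro j hj
    exact ⟨_, by split_ifs <;> omega, hv j⟩
  · intro j hj
    simp [not_lt.2 hj]
  · intro j hj
    simp [not_le.2 hj]
  · intro j hj
    exact ⟨i - j, by omega, by simp [hj]⟩

/-- If a vertex `u` off the path lies in the first hyperedge and in `e i`, then `u` may replace
`v (i - 1)`, with the part before `e i` reversed. -/
theorem rotate_through (h : H.IsSemiPath F e v t) {i : ℕ} (hi : i + 1 < t) {u : V}
    (hu : ∀ j < t, v j ≠ u) (hu0 : u ∈ H.edge (e 0)) (hui : u ∈ H.edge (e (i + 1))) :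
    ∃ e' v', H.IsSemiPath F e' v' t ∧ e' 0 = e i ∧ (∀ j < t, v' j ≠ v i) ∧
      (∀ j, i < j → e' j = e j) ∧ ∀ j ≤ i, ∃ j' ≤ i, e' j = e j' := by
  have he : ∀ j, (if j ≤ i then e (i - j) else e j) = e (if j ≤ i then i - j else j) := by
    intro j; split_ifs <;> rfl
  have hv : ∀ j, j ≠ i → (if j < i then v (i - 1 - j) else if j = i then u else v j) =
      v (if j < i then i - 1 - j else j) := by
    intro j hj; simp only [hj, if_false]; split_ifs <;> rfl
  -- The new order is `e i, v (i - 1), …, v 0, e 0, u, e (i + 1), …`, which frees `v i`.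
  refine ⟨fun j => if j ≤ i then e (i - j) else e j,
    fun j => if j < i then v (i - 1 - j) else if j = i then u else v j,
    ⟨?_, ?_, ?_, ?_, ?_⟩, ?_, ?_, ?_, ?_⟩
  · intro j hj
    simp only [he]
    exact h.mem _ (by split_ifs <;> omega)
  · intro a ha b hb hab
    simp only [he] at hab
    have := h.inj_edge _ (by split_ifs <;> omega) _ (by split_ifs <;> omega) hab
    split_ifs at this <;> omega
  · intro a ha b hb hab
    by_cases hai : a = i
    · by_cases hbi : b = i
      · omega
      · simp only [hv b hbi] at hab
        simp only [hai, lt_irrefl, if_true, if_false] at hab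
        exact absurd hab.symm (hu _ (by split_ifs <;> omega))
    · by_cases hbi : b = i
      · simp only [hv a hai] at hab
        simp only [hbi, lt_irrefl, if_true, if_false] at hab
        exact absurd hab (hu _ (by split_ifs <;> omega))
      · simp only [hv a hai, hv b hbi] at hab
        have := h.inj_vert _ (by split_ifs <;> omega) _ (by split_ifs <;> omega) hab
        split_ifs at this <;> omega
  · intro j hj
    rcases lt_trichotomy j i with hji | rfl | hji
    · simp only [hji, hji.le, if_true]
      have := h.right (i - 1 - j) (by omega)
      rwa [show i - 1 - j + 1 = i - j by omega] at this
    · simpa using hu0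
    · simp only [not_lt.2 hji.le, not_le.2 hji, hji.ne', if_false]
      exact h.left j hj
  · intro j hj
    rcases lt_trichotomy j i with hji | rfl | hji
    · simp only [hji, Nat.succ_le_of_lt hji, if_true]
      have := h.left (i - 1 - j) (by omega)
      rwa [show i - 1 - j = i - (j + 1) by omega] at this ⊢
    · simpa using hui
    · simp only [not_lt.2 hji.le, show ¬ (j + 1 ≤ i) by omega, hji.ne', if_false]
      exact h.right j hj
  · simp
  · intro j hj hji
    by_cases hj' : j = i
    · simp only [hj', lt_irrefl, if_true, if_false] at hji
      exact hu i (by omega) hji.symm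
    · simp only [hv j hj'] at hji
      have := h.inj_vert _ (by split_ifs <;> omega) _ (by omega) hji
      split_ifs at this <;> omega
  · intro j hj
    simp [not_le.2 hj]
  · intro j hj
    exact ⟨i - j, by omega, by simp [hj]⟩

theorem length_le (h : H.IsSemiPath F e v t) : t ≤ F.card := by
  classical
  have := Finset.card_le_card_of_injOn (s := Finset.range t) (t := F) e
    (fun j hj => h.mem j (Finset.mem_range.1 hj))
    (fun i hi j hj => h.inj_edge i (by simpa using hi) j (by simpa using hj))
  simpa using this

end IsSemiPath

/-! ### The sparse set from a longest semi-path -/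

theorem exists_longest_semiPath {F : Finset E} {r : ℕ} (hr : 1 ≤ r) (hH : H.IsUniform r)
    (hF : F.Nonempty) :
    ∃ e v t, 0 < t ∧ H.IsSemiPath F e v t ∧ ∀ e' v' t', H.IsSemiPath F e' v' t' → t' ≤ t := by
  obtain ⟨f, hf⟩ := hF
  obtain ⟨x, hx⟩ : (H.edge f).Nonempty := Finset.card_pos.1 (by rw [hH f]; omega)
  let T : Set ℕ := {t | ∃ e v, H.IsSemiPath F e v t}
  have hbdd : BddAbove T := ⟨F.card, by rintro t ⟨e, v, h⟩; exact h.length_le⟩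
  have h1 : 1 ∈ T := ⟨fun _ => f, fun _ => x, fun _ _ => hf, fun _ _ _ _ _ => by omega,
    fun _ _ _ _ _ => by omega, fun _ _ => hx, fun _ _ => hx⟩
  obtain ⟨e, v, h⟩ := Nat.sSup_mem ⟨1, h1⟩ hbdd
  exact ⟨e, v, _, le_csSup hbdd h1, h, fun e' v' t' h' => le_csSup hbdd ⟨e', v', h'⟩⟩

open Classical in
/-- In an `r`-uniform multi-hypergraph without Berge cycles of length at least `k ≤ r`, some
`r - 1` vertices are together incident with at most `k - 1` hyperedges. -/
theorem exists_sparse_set {F : Finset E} {k r : ℕ} (hk : 2 ≤ k) (hkr : k ≤ r)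
    (hH : H.IsUniform r) (hfree : H.BergeCycleFree k) (hF : F.Nonempty) :
    ∃ S : Finset V, S.card = r - 1 ∧ (∀ s ∈ S, ∃ f ∈ F, s ∈ H.edge f) ∧
      (F.filter fun f => ∃ s ∈ S, s ∈ H.edge f).card ≤ k - 1 := by
  obtain ⟨e, v, t, ht, h, hmax⟩ := exists_longest_semiPath (by omega) hH hF
  -- `A` lists the admissible rotations, and `O i` the off-path vertices exposed by the rotation at
  -- `i`. An index in `N` has an `O i` that overlaps an earlier one; the path vertex `v (i - 1)`
  -- makes up for that loss.
  let A := (Finset.range t).filter fun i => v i ∈ H.edge (e 0)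
  let O : ℕ → Finset V := fun i => (H.edge (e i)).filter fun w => ∀ j < t, v j ≠ w
  let N := A.filter fun i => ∃ l ∈ A, l < i ∧ ¬ Disjoint (O i) (O l)
  have hA : ∀ i, i ∈ A ↔ i < t ∧ v i ∈ H.edge (e 0) := fun i => by simp [A]
  have hAk : ∀ i ∈ A, i + 1 < k := fun i hi =>
    h.lt_of_bergeCycleFree hfree ((hA i).1 hi).1 ((hA i).1 hi).2
  have hN : ∀ i, i ∈ N ↔ i ∈ A ∧ ∃ l ∈ A, l < i ∧ ¬ Disjoint (O i) (O l) := fun i => by simp [N]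
  have h0A : 0 ∈ A := (hA 0).2 ⟨ht, h.left 0 ht⟩
  have h0N : 0 ∉ N := fun h0 => by
    obtain ⟨_, l, _, hl, _⟩ := (hN 0).1 h0
    omega
  have hO : ∀ i w, w ∈ O i ↔ w ∈ H.edge (e i) ∧ ∀ j < t, v j ≠ w := fun i w => by simp [O]
  let W₁ := (A \ N).biUnion O
  let W₂ := N.image fun i => v (i - 1)
  -- hyperedges at vertices of `W₁` and `W₂` are among the first `k - 1`
  have hW₁ : ∀ i ∈ A, ∀ w ∈ O i, ∀ f ∈ F, w ∈ H.edge f → ∃ j < t, j < k - 1 ∧ f = e j := by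
    intro i hi w hw f hf hwf
    have hik := hAk i hi
    obtain ⟨hit, hi0⟩ := (hA i).1 hi
    obtain ⟨hwi, hwv⟩ := (hO i w).1 hw
    obtain ⟨e', v', h', he0, hv', -, heq, hle⟩ := h.rotate hit hi0
    obtain ⟨j, hjt, hjk, rfl⟩ := h'.exists_eq_edge_of_mem hk hfree hmax (w := w)
      (by rw [he0]; exact hwi)
      (fun j hj => by obtain ⟨j', hj', hjj⟩ := hv' j hj; rw [hjj]; exact hwv j' hj') hf hwf
    rcases le_or_gt j i with hji | hji
    · obtain ⟨j', hj', hjj⟩ := hle j hji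
      exact ⟨j', by omega, by omega, hjj⟩
    · exact ⟨j, hjt, hjk, heq j hji⟩
  have hW₂ : ∀ i ∈ N, ∀ f ∈ F, v (i - 1) ∈ H.edge f → ∃ j < t, j < k - 1 ∧ f = e j := by
    intro i hi f hf hwf
    obtain ⟨hiA, l, hl, hli, hdis⟩ := (hN i).1 hi
    have hik := hAk i hiA
    obtain ⟨u, hui, hul⟩ := Finset.not_disjoint_iff.1 hdis
    obtain ⟨hit, hi0⟩ := (hA i).1 hiA
    obtain ⟨hlt, hl0⟩ := (hA l).1 hl
    obtain ⟨hui, huv⟩ := (hO i u).1 hui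
    obtain ⟨hul, -⟩ := (hO l u).1 hul
    obtain ⟨i, rfl⟩ : ∃ i', i = i' + 1 := ⟨i - 1, by omega⟩
    -- Rotating at `l` puts a hyperedge containing `u` in front; a second rotation through `u` then
    -- takes `v i` off the path while it lies in the new first hyperedge.
    obtain ⟨e', v', h', he0, hv', hveq, heq, hle⟩ := h.rotate hlt hl0
    obtain ⟨e'', v'', h'', he0'', hv'', heq'', hle''⟩ := h'.rotate_through (i := i) (u := u) hit
      (fun j hj => by obtain ⟨j', hj', hjj⟩ := hv' j hj; rw [hjj]; exact huv j' hj')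
      (by rw [he0]; exact hul) (by rw [heq _ hli]; exact hui)
    rw [hveq i (by omega)] at hv''
    obtain ⟨j, hjt, hjk, rfl⟩ := h''.exists_eq_edge_of_mem hk hfree hmax (w := v i)
      (by rw [he0'', ← hveq i (by omega)]; exact h'.left i (by omega)) hv'' hf hwf
    obtain ⟨j₁, hj₁t, hj₁k, hj₁⟩ : ∃ j₁ < t, j₁ < k - 1 ∧ e'' j = e' j₁ := by
      rcases le_or_gt j i with hji | hji
      · obtain ⟨j', hj', hjj⟩ := hle'' j hji
        exact ⟨j', by omega, by omega, hjj⟩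
      · exact ⟨j, hjt, hjk, heq'' j hji⟩
    rw [hj₁]
    rcases le_or_gt j₁ l with hji | hji
    · obtain ⟨j', hj', hjj⟩ := hle j₁ hji
      exact ⟨j', by omega, by omega, hjj⟩
    · exact ⟨j₁, hj₁t, hj₁k, heq j₁ hji⟩
  -- sizes
  have hO0 : (O 0).card + A.card = r := by
    rw [← hH (e 0), ← Finset.card_filter_add_card_filter_not (s := H.edge (e 0))
      (fun w => ∀ j < t, v j ≠ w)]
    congr 1
    rw [← Finset.card_image_of_injOn (s := A) (f := v)]
    · congr 1
      ext w
      simp only [Finset.mem_image, hA, Finset.mem_filter]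
      constructor
      · rintro ⟨i, ⟨hi, hi0⟩, rfl⟩
        exact ⟨hi0, fun hw => hw i hi rfl⟩
      · rintro ⟨hw, hw'⟩
        push Not at hw'
        obtain ⟨j, hj, rfl⟩ := hw'
        exact ⟨j, ⟨hj, hw⟩, rfl⟩
    · intro i hi j hj hij
      exact h.inj_vert i ((hA i).1 hi).1 j ((hA j).1 hj).1 hij
  have hOpos : ∀ i ∈ A, 1 ≤ (O i).card := by
    intro i hi
    have hik := hAk i hi
    obtain ⟨hit, hi0⟩ := (hA i).1 hi
    obtain ⟨e', v', h', he0, -, hveq, -, -⟩ := h.rotate hit hi0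
    by_contra hcard
    -- Otherwise all `r` vertices of `e i` would be among the first `k - 1` path vertices: later
    -- ones are excluded by the rotation at `i`, which leaves them in place.
    have hempty : O i = ∅ := Finset.card_eq_zero.1 (by omega)
    have hsub : H.edge (e i) ⊆ (Finset.range (k - 1)).image v := by
      intro w hw
      by_cases hwv : ∀ j < t, v j ≠ w
      · have := (hO i w).2 ⟨hw, hwv⟩
        simp [hempty] at this
      · push Not at hwv
        obtain ⟨j, hj, rfl⟩ := hwv
        refine Finset.mem_image_of_mem _ (Finset.mem_range.2 ?_)
        rcases le_or_gt j i with hji | hji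
        · omega
        · have := h'.lt_of_bergeCycleFree hfree hj (by rw [hveq j hji.le, he0]; exact hw)
          omega
    have h1 := Finset.card_le_card hsub
    have h2 := Finset.card_image_le (s := Finset.range (k - 1)) (f := v)
    rw [hH] at h1
    rw [Finset.card_range] at h2
    omega
  have hcard₁ : (O 0).card + ((A \ N).card - 1) ≤ W₁.card := by
    have h0 : 0 ∈ A \ N := Finset.mem_sdiff.2 ⟨h0A, h0N⟩
    rw [Finset.card_biUnion, ← Finset.add_sum_erase _ _ h0, ← Finset.card_erase_of_mem h0]
    · gcongr
      rw [Finset.card_eq_sum_ones]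
      exact Finset.sum_le_sum fun i hi =>
        hOpos i (Finset.mem_sdiff.1 (Finset.mem_of_mem_erase hi)).1
    · have key : ∀ i ∈ A \ N, ∀ j ∈ A \ N, j < i → Disjoint (O i) (O j) := by
        intro i hi j hj hij
        by_contra hd
        exact (Finset.mem_sdiff.1 hi).2 ((hN i).2
          ⟨(Finset.mem_sdiff.1 hi).1, j, (Finset.mem_sdiff.1 hj).1, hij, hd⟩)
      intro i hi j hj hij
      rcases lt_or_gt_of_ne hij with hlt | hlt
      · exact (key j hj i hi hlt).symm
      · exact key i hi j hj hlt
  have hcard₂ : W₂.card = N.card := by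
    refine Finset.card_image_of_injOn fun i hi j hj hij => ?_
    obtain ⟨hi1, l, -, hl, -⟩ := (hN i).1 hi
    obtain ⟨hj1, l', -, hl', -⟩ := (hN j).1 hj
    have hi2 := ((hA i).1 hi1).1
    have hj2 := ((hA j).1 hj1).1
    have := h.inj_vert (i - 1) (by omega) (j - 1) (by omega) hij
    omega
  have hdisj : Disjoint W₁ W₂ := by
    rw [Finset.disjoint_left]
    intro w hw₁ hw₂
    obtain ⟨i, -, hi⟩ := Finset.mem_biUnion.1 hw₁
    obtain ⟨j, hj, rfl⟩ := Finset.mem_image.1 hw₂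
    have := ((hA j).1 ((hN j).1 hj).1).1
    exact ((hO i _).1 hi).2 (j - 1) (by omega) rfl
  have hNA : N ⊆ A := Finset.filter_subset _ _
  -- The count is `(r - |A|) + (|A \ N| - 1) + |N| = r - 1`.
  have hcard : r - 1 ≤ (W₁ ∪ W₂).card := by
    rw [Finset.card_union_of_disjoint hdisj, hcard₂]
    have h1 := Finset.card_sdiff_add_card_eq_card hNA
    have h2 : 0 < (A \ N).card := Finset.card_pos.2 ⟨0, Finset.mem_sdiff.2 ⟨h0A, h0N⟩⟩
    omega
  obtain ⟨S, hSW, hS⟩ := Finset.exists_subset_card_eq hcard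
  refine ⟨S, hS, ?_, ?_⟩
  · intro s hs
    rcases Finset.mem_union.1 (hSW hs) with hs | hs
    · obtain ⟨i, hi, his⟩ := Finset.mem_biUnion.1 hs
      have := ((hA i).1 (Finset.mem_sdiff.1 hi).1).1
      exact ⟨e i, h.mem i this, ((hO i s).1 his).1⟩
    · obtain ⟨i, hi, rfl⟩ := Finset.mem_image.1 hs
      have := ((hA i).1 (hNA hi)).1
      exact ⟨e (i - 1), h.mem _ (by omega), h.left _ (by omega)⟩
  · refine (Finset.card_le_card (t := (Finset.range (k - 1)).image e) ?_).trans
      (Finset.card_image_le.trans (by simp))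
    intro f hf
    obtain ⟨hfF, s, hs, hsf⟩ := Finset.mem_filter.1 hf
    have : ∃ j < t, j < k - 1 ∧ f = e j := by
      rcases Finset.mem_union.1 (hSW hs) with hs | hs
      · obtain ⟨i, hi, his⟩ := Finset.mem_biUnion.1 hs
        exact hW₁ i (Finset.mem_sdiff.1 hi).1 s his f hfF hsf
      · obtain ⟨i, hi, rfl⟩ := Finset.mem_image.1 hs
        exact hW₂ i hi f hfF hsf
    obtain ⟨j, -, hj, rfl⟩ := this
    exact Finset.mem_image_of_mem _ (Finset.mem_range.2 hj)

end MultiHypergraph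

/-! ### Biconnected vertex sets -/

namespace SimpleGraph

variable {V : Type*} {G G' : SimpleGraph V}

/-- `T` has at least two vertices and induces a connected subgraph without a cut vertex. -/
def IsBiconnectedOn (G : SimpleGraph V) (T : Set V) : Prop :=
  T.Nontrivial ∧ (G.induce T).Connected ∧ ∀ v ∈ T, (G.induce (T \ {v})).Connected

theorem IsBiconnectedOn.connected_diff {T : Set V} (h : G.IsBiconnectedOn T) (v : V) :
    (G.induce (T \ {v})).Connected := by
  by_cases hv : v ∈ T
  · exact h.2.2 v hv
  · rw [Set.sdiff_singleton_eq_self hv]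
    exact h.2.1

theorem induce_congr_of_adj {T : Set V} (h : ∀ u ∈ T, ∀ w ∈ T, G.Adj u w ↔ G'.Adj u w) :
    G.induce T = G'.induce T := by
  ext u w
  exact h u u.2 w w.2

theorem IsBiconnectedOn.congr {T : Set V} (hG : G.IsBiconnectedOn T)
    (h : ∀ u ∈ T, ∀ w ∈ T, G.Adj u w ↔ G'.Adj u w) : G'.IsBiconnectedOn T := by
  refine ⟨hG.1, ?_, fun v hv => ?_⟩
  · rw [← induce_congr_of_adj h]
    exact hG.2.1
  · rw [← induce_congr_of_adj fun u hu w hw => h u hu.1 w hw.1]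
    exact hG.2.2 v hv

theorem Connected.exists_adj_mem_notMem (hG : G.Connected) {A : Set V} {a b : V}
    (ha : a ∈ A) (hb : b ∉ A) : ∃ u ∈ A, ∃ w ∉ A, G.Adj u w := by
  obtain ⟨p⟩ := hG.preconnected a b
  obtain ⟨d, -, hd, hd'⟩ := p.exists_boundary_dart A ha hb
  exact ⟨d.fst, hd, d.snd, hd', d.adj⟩

theorem exists_adj_mem_notMem_of_induce_connected {T A : Set V} (hG : (G.induce T).Connected)
    {a b : V} (haT : a ∈ T) (ha : a ∈ A) (hbT : b ∈ T) (hb : b ∉ A) :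
    ∃ u ∈ T, u ∈ A ∧ ∃ w ∈ T, w ∉ A ∧ G.Adj u w := by
  obtain ⟨u, hu, w, hw, huw⟩ := hG.exists_adj_mem_notMem (A := Subtype.val ⁻¹' A)
    (a := ⟨a, haT⟩) (b := ⟨b, hbT⟩) ha hb
  exact ⟨u, u.2, hu, w, w.2, hw, huw⟩

theorem induce_connected_of_isClique {T : Set V} (hT : G.IsClique T) (hne : T.Nonempty) :
    (G.induce T).Connected := by
  have := hne.to_subtype
  refine ⟨fun u w => ?_⟩
  by_cases huw : u = w
  · rw [huw]
  · exact Adj.reachable (hT u.2 w.2 (Subtype.coe_injective.ne huw))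

theorem IsClique.isBiconnectedOn {T : Set V} (hT : G.IsClique T) (hne : T.Nontrivial) :
    G.IsBiconnectedOn T := by
  refine ⟨hne, induce_connected_of_isClique hT hne.nonempty, fun v hv => ?_⟩
  obtain ⟨w, hw, hwv⟩ := hne.exists_ne v
  exact induce_connected_of_isClique (hT.subset Set.sdiff_subset) ⟨w, hw, hwv⟩

end SimpleGraph

/-! ### The upper bound and the structure of equality -/

namespace MultiHypergraph

variable {V E : Type*} {H : MultiHypergraph V E}

open Classical in
theorem exists_sparse_subset {X : Finset V} {F : Finset E} {k r : ℕ} (hk : 2 ≤ k) (hkr : k ≤ r)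
    (hH : H.IsUniform r) (hfree : H.BergeCycleFree k) (hX : r ≤ X.card)
    (hFX : ∀ f ∈ F, H.edge f ⊆ X) :
    ∃ S ⊆ X, S.card = r - 1 ∧ (F.filter fun f => ∃ s ∈ S, s ∈ H.edge f).card ≤ k - 1 := by
  rcases F.eq_empty_or_nonempty with rfl | hF
  · obtain ⟨S, hS, hcard⟩ := Finset.exists_subset_card_eq (show r - 1 ≤ X.card by omega)
    exact ⟨S, hS, hcard, by simp⟩
  · obtain ⟨S, hS, hSF, hcard⟩ := exists_sparse_set hk hkr hH hfree hF
    refine ⟨S, fun s hs => ?_, hS, hcard⟩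
    obtain ⟨f, hf, hsf⟩ := hSF s hs
    exact hFX f hf hsf

open Classical in
theorem edge_subset_sdiff {X S : Finset V} {F : Finset E} (hFX : ∀ f ∈ F, H.edge f ⊆ X) :
    ∀ f ∈ F.filter fun f => ¬ ∃ s ∈ S, s ∈ H.edge f, H.edge f ⊆ X \ S := by
  intro f hf w hw
  rw [Finset.mem_filter] at hf
  exact Finset.mem_sdiff.2 ⟨hFX f hf.1 hw, fun hwS => hf.2 ⟨w, hwS, hw⟩⟩

/-- Peeling a sparse set lowers the quotient by one and costs at most `k - 1` hyperedges. The form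
relative to `X` and `F` lets the induction keep `H` fixed. -/
theorem card_le_of_bergeCycleFree {k r : ℕ} (hk : 2 ≤ k) (hkr : k ≤ r)
    (hH : H.IsUniform r) (hfree : H.BergeCycleFree k) (X : Finset V) (F : Finset E)
    (hX : X.Nonempty) (hFX : ∀ f ∈ F, H.edge f ⊆ X) :
    F.card ≤ (X.card - 1) / (r - 1) * (k - 1) := by
  classical
  induction hn : X.card using Nat.strong_induction_on generalizing X F with
  | _ n ih =>
  subst hn
  by_cases hr : r ≤ X.card
  · obtain ⟨S, hSX, hS, hcard⟩ := exists_sparse_subset hk hkr hH hfree hr hFX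
    have hXS := Finset.card_sdiff_of_subset hSX
    have h1 := ih (X \ S).card (by omega) (X \ S)
      (F.filter fun f => ¬ ∃ s ∈ S, s ∈ H.edge f) (Finset.card_pos.1 (by omega))
      (edge_subset_sdiff hFX) rfl
    have h2 := Finset.card_filter_add_card_filter_not (s := F) fun f => ∃ s ∈ S, s ∈ H.edge f
    have h3 : (X.card - 1) / (r - 1) = ((X \ S).card - 1) / (r - 1) + 1 := by
      rw [← Nat.add_div_right _ (by omega)]
      congr 1
      omega
    rw [h3, add_mul, one_mul]
    omega
  · suffices F = ∅ by simp [this]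
    refine Finset.eq_empty_of_forall_notMem fun f hf => hr ?_
    rw [← hH f]
    exact Finset.card_le_card (hFX f hf)

/-- The 2-shadow of the hyperedges in `F`. -/
def shadowOn (H : MultiHypergraph V E) (F : Finset E) : SimpleGraph V where
  Adj u v := u ≠ v ∧ ∃ e ∈ F, u ∈ H.edge e ∧ v ∈ H.edge e
  symm := ⟨fun _ _ h => ⟨h.1.symm, h.2.imp fun _ he => ⟨he.1, he.2.2, he.2.1⟩⟩⟩
  loopless := ⟨fun _ h => h.1 rfl⟩

theorem shadowOn_univ [Fintype E] : H.shadowOn Finset.univ = H.shadow := by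
  ext u v
  simp [shadowOn, shadow]

/-- A Berge path with at least `k - 1` hyperedges of `F` joins `x` to `y`. -/
def Joined (H : MultiHypergraph V E) (F : Finset E) (k : ℕ) (x y : V) : Prop :=
  ∃ e v t, H.IsSemiPath F e v (t + 1) ∧ k - 1 ≤ t + 1 ∧ x ∈ H.edge (e 0) ∧
    (∀ j < t + 1, v j ≠ x) ∧ v t = y

theorem Joined.mono {F F' : Finset E} {k : ℕ} {x y : V} (h : H.Joined F k x y) (hF : F ⊆ F') :
    H.Joined F' k x y := by
  obtain ⟨e, v, t, h, h'⟩ := h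
  exact ⟨e, v, t, h.mono hF, h'⟩

theorem Joined.symm {F : Finset E} {k : ℕ} {x y : V} (h : H.Joined F k x y) :
    H.Joined F k y x := by
  obtain ⟨e, v, t, h, hkt, hx, hxv, rfl⟩ := h
  have hv : ∀ j, (if j < t then v (t - 1 - j) else x) = seqCons x v (t - j) := by
    intro j
    split_ifs with hj
    · obtain ⟨i, hi⟩ : ∃ i, t - j = i + 1 := ⟨t - 1 - j, by omega⟩
      rw [hi, show t - 1 - j = i by omega]
      rfl
    · rw [show t - j = 0 by omega]
      rfl
  have hinj : ∀ i < t + 2, ∀ j < t + 2, seqCons x v i = seqCons x v j → i = j := by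
    rintro (_ | i) hi (_ | j) hj hij
    · rfl
    · exact absurd hij.symm (hxv j (by omega))
    · exact absurd hij (hxv i (by omega))
    · rw [h.inj_vert i (by omega) j (by omega) hij]
  -- The full vertex sequence is `x, v 0, …, v t`; read backwards from `v t`, it lists indices `t,
  -- …, 0` after the start.
  refine ⟨fun j => e (t - j), fun j => seqCons x v (t - j), t, ⟨?_, ?_, ?_, ?_, ?_⟩,
    hkt, h.left t (by omega), ?_, by simp [seqCons]⟩
  · intro j hj
    exact h.mem _ (by omega)
  · intro i hi j hj hij
    have := h.inj_edge _ (by omega) _ (by omega) hij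
    omega
  · intro i hi j hj hij
    have := hinj _ (by omega) _ (by omega) hij
    omega
  · intro j hj
    obtain hi | ⟨i, hi⟩ : t - j = 0 ∨ ∃ i, t - j = i + 1 := by
      rcases Nat.eq_zero_or_eq_succ_pred (t - j) with h | h
      · exact Or.inl h
      · exact Or.inr ⟨_, h⟩
    · simp only [hi]
      exact hx
    · simp only [hi]
      exact h.right i (by omega)
  · intro j hj
    obtain ⟨i, hi⟩ : ∃ i, t - j = i + 1 := ⟨t - 1 - j, by omega⟩
    simp only [hi, show t - (j + 1) = i by omega]
    exact h.left i (by omega)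
  · intro j hj hjt
    have := hinj (t - j) (by omega) (t + 1) (by omega) hjt
    omega

/-- Parallel hyperedges carry a semi-path through all of them that ends at a given vertex. -/
theorem exists_semiPath_of_parallel {D : Finset V} (m : ℕ) :
    ∀ (F : Finset E) (Y : Finset V), F.card = m + 1 → (∀ f ∈ F, H.edge f = D) → Y ⊆ D →
      m + 1 ≤ Y.card → ∀ y ∈ Y, ∃ e v, H.IsSemiPath F e v (m + 1) ∧ v m = y ∧
        ∀ j < m + 1, v j ∈ Y := by
  classical
  induction m with
  | zero =>
    intro F Y hF hFD hYD _ y hy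
    obtain ⟨f, hf⟩ := Finset.card_pos.1 (show 0 < F.card by omega)
    have hyf : y ∈ H.edge f := by rw [hFD f hf]; exact hYD hy
    exact ⟨fun _ => f, fun _ => y, ⟨fun _ _ => hf, fun _ _ _ _ _ => by omega,
      fun _ _ _ _ _ => by omega, fun _ _ => hyf, fun _ _ => hyf⟩, rfl, fun _ _ => hy⟩
  | succ m ih =>
    intro F Y hF hFD hYD hY y hy
    obtain ⟨f, hf⟩ := Finset.card_pos.1 (show 0 < F.card by omega)
    obtain ⟨z, hz, hzy⟩ := Finset.exists_mem_ne (show 1 < Y.card by omega) y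
    obtain ⟨e, v, h, hvy, hvY⟩ := ih (F.erase f) (Y.erase z)
      (by rw [Finset.card_erase_of_mem hf]; omega)
      (fun g hg => hFD g (Finset.mem_of_mem_erase hg))
      ((Finset.erase_subset _ _).trans hYD)
      (by rw [Finset.card_erase_of_mem hz]; omega) y (Finset.mem_erase.2 ⟨hzy.symm, hy⟩)
    refine ⟨_, _, (h.mono (Finset.erase_subset _ _)).cons hf
      (fun j hj => Finset.ne_of_mem_erase (h.mem j hj))
      (fun j hj => Finset.ne_of_mem_erase (hvY j hj))
      (by rw [hFD f hf]; exact hYD hz)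
      (fun _ => by rw [hFD _ (Finset.mem_of_mem_erase (h.mem 0 (by omega)))]; exact hYD hz),
      hvy, ?_⟩
    rintro (_ | j) hj
    · exact hz
    · exact Finset.mem_of_mem_erase (hvY j (by omega))

theorem joined_of_parallel {D : Finset V} {F : Finset E} {k : ℕ} (hk : 2 ≤ k)
    (hF : F.card = k - 1) (hFD : ∀ f ∈ F, H.edge f = D) (hD : k ≤ D.card) {x y : V}
    (hx : x ∈ D) (hy : y ∈ D) (hxy : x ≠ y) : H.Joined F k x y := by
  classical
  obtain ⟨e, v, h, hvy, hvY⟩ := exists_semiPath_of_parallel (k - 2) F (D.erase x) (by omega) hFD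
    (Finset.erase_subset _ _) (by rw [Finset.card_erase_of_mem hx]; omega) y
    (Finset.mem_erase.2 ⟨hxy.symm, hy⟩)
  exact ⟨e, v, k - 2, h, by omega, by rw [hFD _ (h.mem 0 (by omega))]; exact hx,
    fun j hj => Finset.ne_of_mem_erase (hvY j hj), hvy⟩

open Classical in
/-- Any two vertices of `X` are joined by a long Berge path of `F`, and every biconnected set of
the 2-shadow of `F` within `X` lies in a set of `r` vertices that contains exactly `k - 1`
hyperedges of `F`. -/
structure IsTreeLike (H : MultiHypergraph V E) (k r : ℕ) (X : Finset V) (F : Finset E) :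
    Prop where
  joined : ∀ x ∈ X, ∀ y ∈ X, x ≠ y → H.Joined F k x y
  biconnected : ∀ T : Set V, T ⊆ X → (H.shadowOn F).IsBiconnectedOn T →
    ∃ D : Finset V, T ⊆ D ∧ D.card = r ∧ (F.filter fun f => H.edge f ⊆ D).card = k - 1

open Classical in
/-- A long Berge path leaves no room for further hyperedges, except parallel ones that meet its
vertex set in one common vertex. -/
theorem IsTreeLike.exists_edge_eq_insert {k r : ℕ} (hk : 2 ≤ k) (hkr : k ≤ r)
    (hH : H.IsUniform r) (hfree : H.BergeCycleFree k) {X S : Finset V} {F F' : Finset E}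
    (hT : H.IsTreeLike k r X F) (hXS : Disjoint X S) (hS : S.card = r - 1)
    (hFX : ∀ f ∈ F, H.edge f ⊆ X) (hF' : ∀ f ∈ F', H.edge f ⊆ X ∪ S)
    (hFF' : ∀ f ∈ F', f ∉ F) (hne : F'.Nonempty) :
    ∃ x ∈ X, ∀ f ∈ F', H.edge f = insert x S := by
  have h1 : ∀ f ∈ F', ∃ x ∈ X, H.edge f = insert x S := by
    intro f hf
    have hle : (H.edge f \ S).card ≤ 1 := by
      rw [Finset.card_le_one]
      intro x hx y hy
      by_contra hxy
      rw [Finset.mem_sdiff] at hx hy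
      have hxX : x ∈ X := (Finset.mem_union.1 (hF' f hf hx.1)).resolve_right hx.2
      have hyX : y ∈ X := (Finset.mem_union.1 (hF' f hf hy.1)).resolve_right hy.2
      obtain ⟨e, v, t, h, hkt, hx0, hxv, rfl⟩ := hT.joined x hxX y hyX hxy
      -- Two vertices of `f` outside `S` would close the long path into a cycle with `t + 2 ≥ k`
      -- hyperedges.
      have hc := (h.mono (Finset.subset_insert f F)).cons (Finset.mem_insert_self f F)
        (fun j hj hjf => hFF' f hf (hjf ▸ h.mem j hj)) hxv hx.1 fun _ => hx0
      exact hfree _ (by omega) (hc.hasBergeCycle hy.1)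
    have h2 := Finset.card_sdiff_add_card_inter (H.edge f) S
    have h3 := Finset.card_le_card (Finset.inter_subset_right : H.edge f ∩ S ⊆ S)
    rw [hH] at h2
    obtain ⟨x, hx⟩ := Finset.card_eq_one.1 (show (H.edge f \ S).card = 1 by omega)
    have hSf : H.edge f ∩ S = S :=
      Finset.eq_of_subset_of_card_le Finset.inter_subset_right (by omega)
    have hxf : x ∈ H.edge f \ S := by rw [hx]; exact Finset.mem_singleton_self x
    rw [Finset.mem_sdiff] at hxf
    refine ⟨x, (Finset.mem_union.1 (hF' f hf hxf.1)).resolve_right hxf.2, ?_⟩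
    rw [Finset.insert_eq, ← hx, ← hSf, Finset.sdiff_inter_self_left]
    exact (Finset.sdiff_union_inter _ _).symm
  obtain ⟨f, hf⟩ := hne
  obtain ⟨x, hx, hxf⟩ := h1 f hf
  refine ⟨x, hx, fun g hg => ?_⟩
  obtain ⟨y, hy, hyg⟩ := h1 g hg
  by_cases hxy : x = y
  · rw [hyg, hxy]
  · exfalso
    obtain ⟨s, hs⟩ := Finset.card_pos.1 (show 0 < S.card by omega)
    have hsX : s ∉ X := Finset.disjoint_right.1 hXS hs
    obtain ⟨e, v, t, h, hkt, hx0, hxv, rfl⟩ := hT.joined x hx y hy hxy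
    -- With distinct attachment vertices, the cycle runs `g, s, f, x`, then along the long path to
    -- `y ∈ g`.
    have hc := ((h.mono (show F ⊆ insert g (insert f F) from
        (Finset.subset_insert f F).trans (Finset.subset_insert g _))).cons (g := f) (x := x)
      (by simp) (fun j hj hjf => hFF' f hf (hjf ▸ h.mem j hj)) hxv (by simp [hxf])
      fun _ => hx0).cons (g := g) (x := s) (by simp) ?_ ?_ (by simp [hyg, hs])
      fun _ => by simp [seqCons, hxf, hs]
    · exact hfree _ (by omega) (hc.hasBergeCycle (by simp [seqCons, hyg]))
    · rintro (_ | j) hj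
      · rintro (rfl : f = g)
        have : v t ∈ insert x S := by rw [← hxf, hyg]; simp
        rcases Finset.mem_insert.1 this with h' | h'
        · exact hxy h'.symm
        · exact Finset.disjoint_left.1 hXS hy h'
      · intro hjg
        exact hFF' g hg (hjg ▸ h.mem j (by omega))
    · rintro (_ | j) hj
      · rintro (rfl : x = s)
        exact hsX hx
      · rintro (rfl : v j = s)
        exact hsX (hFX _ (h.mem j (by omega)) (h.left j (by omega)))

-- Parallel hyperedges join vertices of the new block; from `S` to the old part, one new hyperedge
-- leads to `x` and an old path continues. Since `x` separates `S` from the rest of `X`, no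
-- biconnected set straddles it.
open Classical in
theorem IsTreeLike.glue {k r : ℕ} (hk : 2 ≤ k) (hkr : k ≤ r)
    (hH : H.IsUniform r) {X S : Finset V} {F F' : Finset E} (hT : H.IsTreeLike k r X F)
    (hXS : Disjoint X S) (hS : S.card = r - 1) (hFX : ∀ f ∈ F, H.edge f ⊆ X)
    (hFF' : ∀ f ∈ F', f ∉ F) (hcard : F'.card = k - 1) {x : V} (hx : x ∈ X)
    (hF' : ∀ f ∈ F', H.edge f = insert x S) : H.IsTreeLike k r (X ∪ S) (F ∪ F') := by
  have hxS : x ∉ S := Finset.disjoint_left.1 hXS hx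
  have hDcard : (insert x S).card = r := by rw [Finset.card_insert_of_notMem hxS]; omega
  obtain ⟨f, hf⟩ := Finset.card_pos.1 (show 0 < F'.card by omega)
  have hjD : ∀ y ∈ insert x S, ∀ z ∈ insert x S, y ≠ z → H.Joined (F ∪ F') k y z :=
    fun y hy z hz hyz => (joined_of_parallel hk hcard hF' (by omega) hy hz hyz).mono
      Finset.subset_union_right
  have hjXS : ∀ y ∈ X, ∀ s ∈ S, H.Joined (F ∪ F') k s y := by
    intro y hy s hs
    by_cases hxy : x = y
    · subst hxy
      exact hjD s (by simp [hs]) x (by simp) (fun h => hxS (h ▸ hs))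
    · obtain ⟨e, v, t, h, hkt, hx0, hxv, rfl⟩ := hT.joined x hx y hy hxy
      have hsX : s ∉ X := Finset.disjoint_right.1 hXS hs
      refine ⟨_, _, t + 1, (h.mono Finset.subset_union_left).cons (g := f) (x := x)
        (Finset.mem_union_right _ hf) (fun j hj hjf => hFF' f hf (hjf ▸ h.mem j hj)) hxv
        (by simp [hF' f hf]) fun _ => hx0, by omega, by simp [seqCons, hF' f hf, hs], ?_, rfl⟩
      rintro (_ | j) hj
      · rintro (rfl : x = s)
        exact hsX hx
      · rintro (rfl : v j = s)
        exact hsX (hFX _ (h.mem j (by omega)) (h.left j (by omega)))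
  refine ⟨?_, ?_⟩
  · intro y hy z hz hyz
    rcases Finset.mem_union.1 hy with hy | hy <;> rcases Finset.mem_union.1 hz with hz | hz
    · exact (hT.joined y hy z hz hyz).mono Finset.subset_union_left
    · exact (hjXS y hy z hz).symm
    · exact hjXS z hz y hy
    · exact hjD y (by simp [hy]) z (by simp [hz]) hyz
  · intro T hTX hTb
    by_cases hTS : ∃ s ∈ T, s ∈ S
    · obtain ⟨s, hsT, hsS⟩ := hTS
      refine ⟨insert x S, ?_, hDcard, ?_⟩
      · by_contra hsub
        obtain ⟨y, hyT, hyD⟩ := Set.not_subset.1 hsub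
        rw [Finset.mem_coe, Finset.mem_insert, not_or] at hyD
        obtain ⟨u, -, huS, w, ⟨-, hwx⟩, hwS, huw⟩ :=
          SimpleGraph.exists_adj_mem_notMem_of_induce_connected (A := (S : Set V))
            (hTb.connected_diff x) (a := s) ⟨hsT, fun h => hxS (h ▸ hsS)⟩ hsS
            (b := y) ⟨hyT, hyD.1⟩ hyD.2
        obtain ⟨-, g, hg, hug, hwg⟩ := huw
        rcases Finset.mem_union.1 hg with hg | hg
        · exact Finset.disjoint_left.1 hXS (hFX g hg hug) huS
        · rw [hF' g hg, Finset.mem_insert] at hwg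
          exact hwg.elim hwx hwS
      · rw [← hcard]
        congr 1
        ext g
        rw [Finset.mem_filter, Finset.mem_union]
        constructor
        -- An old hyperedge avoids `S`, so inside `insert x S` it would shrink to `{x}`.
        · rintro ⟨hg | hg, hgD⟩
          · exfalso
            have : H.edge g ⊆ {x} := fun w hw =>
              (Finset.mem_insert.1 (hgD hw)).elim (fun h => Finset.mem_singleton.2 h)
                fun h => (Finset.disjoint_left.1 hXS (hFX g hg hw) h).elim
            have := Finset.card_le_card this
            rw [hH, Finset.card_singleton] at this
            omega
          · exact hg
        · exact fun hg => ⟨Or.inr hg, (hF' g hg).subset⟩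
    · push Not at hTS
      have hTX' : T ⊆ X := fun w hw =>
        (Finset.mem_union.1 (hTX hw)).resolve_right (hTS w hw)
      obtain ⟨D, hTD, hD, hDF⟩ := hT.biconnected T hTX' (hTb.congr fun u hu w hw => by
        refine ⟨?_, fun ⟨huw, g, hg, h⟩ => ⟨huw, g, Finset.mem_union_left _ hg, h⟩⟩
        rintro ⟨huw, g, hg, hug, hwg⟩
        refine ⟨huw, g, (Finset.mem_union.1 hg).resolve_right fun hg => huw ?_, hug, hwg⟩
        rw [hF' g hg, Finset.mem_insert] at hug hwg
        rw [hug.resolve_right (hTS u hu), hwg.resolve_right (hTS w hw)])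
      refine ⟨D, hTD, hD, ?_⟩
      -- As `k - 1 ≥ 1`, the set `D` contains an old hyperedge and so equals it; hence `D` misses
      -- `S` and no new hyperedge fits inside.
      obtain ⟨d, hd⟩ := Finset.card_pos.1 (by rw [hDF]; omega)
      rw [Finset.mem_filter] at hd
      have hdD : H.edge d = D := Finset.eq_of_subset_of_card_le hd.2 (by rw [hD, hH])
      rw [← hDF]
      congr 1
      ext g
      rw [Finset.mem_filter, Finset.mem_filter, Finset.mem_union]
      refine ⟨fun ⟨hg, hgD⟩ => ⟨hg.resolve_right fun hg => ?_, hgD⟩, fun h => ⟨Or.inl h.1, h.2⟩⟩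
      obtain ⟨s, hs⟩ := Finset.card_pos.1 (show 0 < S.card by omega)
      refine Finset.disjoint_right.1 hXS hs (hFX d hd.1 ?_)
      rw [hdD]
      exact hgD (by rw [hF' g hg]; exact Finset.mem_insert_of_mem hs)

/-- At equality, the bound for the peeled part forces exactly `k - 1` hyperedges at `S` and equality
again in the remainder, so the induction hypothesis applies and the new block can be glued on. -/
theorem isTreeLike_of_card_eq {k r : ℕ} (hk : 2 ≤ k) (hkr : k ≤ r)
    (hH : H.IsUniform r) (hfree : H.BergeCycleFree k) (m : ℕ) :
    ∀ (X : Finset V) (F : Finset E), X.card = m * (r - 1) + 1 → (∀ f ∈ F, H.edge f ⊆ X) →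
      F.card = m * (k - 1) → H.IsTreeLike k r X F := by
  classical
  induction m with
  | zero =>
    intro X F hX _ _
    obtain ⟨x, rfl⟩ := Finset.card_eq_one.1 (show X.card = 1 by omega)
    refine ⟨fun a ha b hb hab => ?_, fun T hT hTb => ?_⟩
    · rw [Finset.mem_singleton] at ha hb
      exact absurd (ha.trans hb.symm) hab
    · exact absurd hTb.1 (Set.not_nontrivial_iff.2
        ((Set.subsingleton_singleton (a := x)).anti (by simpa using hT)))
  | succ m ih =>
    intro X F hX hFX hF
    rw [add_mul, one_mul] at hX hF
    obtain ⟨S, hSX, hS, hcard⟩ := exists_sparse_subset hk hkr hH hfree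
      (show r ≤ X.card by omega) hFX
    have hXS := Finset.card_sdiff_of_subset hSX
    have h1 := card_le_of_bergeCycleFree hk hkr hH hfree (X \ S)
      (F.filter fun f => ¬ ∃ s ∈ S, s ∈ H.edge f) (Finset.card_pos.1 (by omega))
      (edge_subset_sdiff hFX)
    have h2 := Finset.card_filter_add_card_filter_not (s := F) fun f => ∃ s ∈ S, s ∈ H.edge f
    rw [show (X \ S).card - 1 = m * (r - 1) by omega, Nat.mul_div_cancel _ (by omega)] at h1
    have hT := ih (X \ S) _ (by omega) (edge_subset_sdiff hFX) (by omega)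
    have hdisj : Disjoint (X \ S) S := Finset.sdiff_disjoint
    have hFF' : ∀ f ∈ F.filter (fun f => ∃ s ∈ S, s ∈ H.edge f),
        f ∉ F.filter fun f => ¬ ∃ s ∈ S, s ∈ H.edge f := by
      intro f hf hf'
      exact (Finset.mem_filter.1 hf').2 (Finset.mem_filter.1 hf).2
    obtain ⟨x, hx, hxF⟩ := hT.exists_edge_eq_insert hk hkr hH hfree hdisj hS
      (edge_subset_sdiff hFX)
      (fun f hf => by
        rw [Finset.sdiff_union_of_subset hSX]
        exact hFX f (Finset.mem_filter.1 hf).1) hFF' (Finset.card_pos.1 (by omega))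
    have := hT.glue hk hkr hH hdisj hS (edge_subset_sdiff hFX) hFF' (by omega) hx hxF
    rwa [Finset.sdiff_union_of_subset hSX, Finset.union_comm,
      Finset.filter_union_filter_not_eq] at this

end MultiHypergraph

/-! ### Cyclic sequences -/

open scoped Fin.NatCast in
-- A cycle with at most one position removed is still a path. The removed position is a deleted
-- vertex in one use, the centre of a sunflower in the other.
theorem Fin.eq_of_forall_eq_add_one {α : Type*} {n : ℕ} {P : Fin (n + 1) → Prop}
    {f : Fin (n + 1) → α} (hP : ∀ i j, ¬ P i → ¬ P j → i = j)
    (hf : ∀ i, P i → P (i + 1) → f i = f (i + 1)) {i j : Fin (n + 1)} (hi : P i) (hj : P j) :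
    f i = f j := by
  by_cases hall : ∀ i, P i
  · have h0 : ∀ i, f i = f 0 := by
      intro i
      induction i using Fin.induction with
      | zero => rfl
      | succ i ih =>
        rw [← ih, ← Fin.coeSucc_eq_succ]
        exact (hf _ (hall _) (hall _)).symm
    rw [h0 i, h0 j]
  · push Not at hall
    obtain ⟨c, hc⟩ := hall
    have hne : ∀ i, i ≠ c → P i := fun i hic => by
      by_contra hi
      exact hic (hP i c hi hc)
    have hs : ∀ s : ℕ, s + 1 < n + 1 → f (c + ((s + 1 : ℕ) : Fin (n + 1))) = f (c + 1) := by
      have hcs : ∀ s : ℕ, s + 1 < n + 1 → c + ((s + 1 : ℕ) : Fin (n + 1)) ≠ c := by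
        intro s hs h
        rw [add_eq_left, Fin.ext_iff, Fin.val_natCast, Nat.mod_eq_of_lt hs] at h
        simp at h
      intro s
      induction s with
      | zero => intro _; simp
      | succ s ih =>
        intro hs
        rw [← ih (by omega)]
        have h1 : c + ((s + 1 + 1 : ℕ) : Fin (n + 1)) = c + ((s + 1 : ℕ) : Fin (n + 1)) + 1 := by
          rw [Nat.cast_add (s + 1) 1, Nat.cast_one, add_assoc]
        have h2 := hcs (s + 1) hs
        rw [h1] at h2 ⊢
        exact (hf _ (hne _ (hcs s (by omega))) (hne _ h2)).symm
    have key : ∀ i, P i → f i = f (c + 1) := by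
      intro i hi
      have hd : i - c ≠ 0 := fun h => hc (by rwa [sub_eq_zero.1 h] at hi)
      obtain ⟨s, hsd⟩ : ∃ s, (i - c).val = s + 1 :=
        ⟨_, (Nat.succ_pred_eq_of_ne_zero (Fin.val_ne_of_ne hd)).symm⟩
      have hlt := (i - c).2
      rw [← hs s (by omega), ← hsd, Fin.cast_val_eq_self, add_sub_cancel]
    rw [key i hi, key j hj]

theorem Fin.add_one_ne_self {n : ℕ} (i : Fin (n + 2)) : i + 1 ≠ i := by
  simp

/-! ### Block trees are extremal, and conversely -/

namespace MultiHypergraph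

variable {V E : Type*} {H : MultiHypergraph V E}

/-- The vertices of the hyperedges of a Berge cycle stay connected in the 2-shadow when at most one
vertex is removed. -/
theorem connected_induce_cycle_sdiff {n : ℕ} {v : Fin (n + 2) → V} {e : Fin (n + 2) → E}
    (hv : Function.Injective v)
    (h : ∀ i, v i ∈ H.edge (e i) ∧ v (i + 1) ∈ H.edge (e i)) {Z : Set V} (hZ : Z.Subsingleton) :
    (H.shadow.induce ({w | ∃ i, w ∈ H.edge (e i)} \ Z)).Connected := by
  set U := {w | ∃ i, w ∈ H.edge (e i)} \ Z with hU
  have hne : ∀ i, v i ∈ Z → v (i + 1) ∈ Z → False := fun i h1 h2 =>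
    Fin.add_one_ne_self i (hv (hZ h2 h1))
  have hvU : ∀ i, v i ∉ Z → v i ∈ U := fun i hi => ⟨⟨i, (h i).1⟩, hi⟩
  have hadj : ∀ i (a b : U), a.1 ∈ H.edge (e i) → b.1 ∈ H.edge (e i) →
      (H.shadow.induce U).Reachable a b := by
    intro i a b ha hb
    by_cases hab : a = b
    · rw [hab]
    · exact SimpleGraph.Adj.reachable
        (⟨Subtype.coe_injective.ne hab, e i, ha, hb⟩ : H.shadow.Adj a b)
  have hcyc : ∀ i j (hi : v i ∉ Z) (hj : v j ∉ Z),
      (H.shadow.induce U).Reachable ⟨v i, hvU i hi⟩ ⟨v j, hvU j hj⟩ := by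
    intro i j hi hj
    -- The function compared along the cycle is the reachability class of `v i`; the existential in
    -- it makes it defined at a deleted position too.
    have := Fin.eq_of_forall_eq_add_one (P := fun i => v i ∉ Z)
      (f := fun i => {b : U | ∃ hi : v i ∉ Z,
        (H.shadow.induce U).Reachable ⟨v i, hvU i hi⟩ b})
      (fun i j hi hj => hv (hZ (not_not.1 hi) (not_not.1 hj)))
      (fun i hi hi' => by
        have hr := hadj i ⟨v i, hvU i hi⟩ ⟨v (i + 1), hvU _ hi'⟩ (h i).1 (h i).2
        ext b
        exact ⟨fun ⟨_, hb⟩ => ⟨hi', hr.symm.trans hb⟩, fun ⟨_, hb⟩ => ⟨hi, hr.trans hb⟩⟩) hi hj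
    have hmem : (⟨v j, hvU j hj⟩ : U) ∈ {b : U | ∃ hi : v i ∉ Z,
        (H.shadow.induce U).Reachable ⟨v i, hvU i hi⟩ b} := by
      have h' : (⟨v j, hvU j hj⟩ : U) ∈ {b : U | ∃ hj : v j ∉ Z,
        (H.shadow.induce U).Reachable ⟨v j, hvU j hj⟩ b} :=
        ⟨hj, SimpleGraph.Reachable.refl _⟩
      exact this ▸ h'
    exact hmem.2
  have hto : ∀ a : U, ∃ i, ∃ hi : v i ∉ Z,
      (H.shadow.induce U).Reachable a ⟨v i, hvU i hi⟩ := by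
    rintro ⟨a, ⟨i, hi⟩, ha⟩
    by_cases hvi : v i ∈ Z
    · exact ⟨i + 1, fun h' => hne i hvi h', hadj i _ _ hi (h i).2⟩
    · exact ⟨i, hvi, hadj i _ _ hi (h i).1⟩
  obtain ⟨i, hi⟩ : ∃ i, v i ∉ Z := by
    by_contra! hall
    exact hne 0 (hall 0) (hall _)
  have : Nonempty U := ⟨⟨v i, hvU i hi⟩⟩
  refine ⟨fun a b => ?_⟩
  obtain ⟨i, hi, hai⟩ := hto a
  obtain ⟨j, hj, hbj⟩ := hto b
  exact hai.trans ((hcyc i j hi hj).trans hbj.symm)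

theorem isBiconnectedOn_cycle {n : ℕ} {v : Fin (n + 2) → V} {e : Fin (n + 2) → E}
    (hv : Function.Injective v) (h : ∀ i, v i ∈ H.edge (e i) ∧ v (i + 1) ∈ H.edge (e i)) :
    H.shadow.IsBiconnectedOn {w | ∃ i, w ∈ H.edge (e i)} := by
  refine ⟨⟨v 0, ⟨0, (h 0).1⟩, v (0 + 1), ⟨0, (h 0).2⟩, fun h0 =>
    Fin.add_one_ne_self 0 (hv h0).symm⟩, ?_, fun x _ =>
    connected_induce_cycle_sdiff hv h Set.subsingleton_singleton⟩
  have := connected_induce_cycle_sdiff hv h Set.subsingleton_empty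
  rwa [Set.sdiff_empty] at this

theorem exists_isBlockSet_superset [Finite V] {G : SimpleGraph V} {T : Set V}
    (hT : G.IsBiconnectedOn T) : ∃ B, T ⊆ B ∧ G.IsBlockSet B :=
  Finite.exists_le_maximal hT

theorem IsBlockTree.bergeCycleFree [Finite V] [Finite E] {r s k : ℕ} (hk : 2 ≤ k)
    (hH : H.IsBlockTree r s (k - 1)) : H.BergeCycleFree k := by
  rintro t ht ⟨v, e, hv, he, hve⟩
  obtain ⟨n, rfl⟩ : ∃ n, t = n + 2 := ⟨t - 2, by omega⟩
  simp only [finRotate_apply] at hve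
  obtain ⟨B, hB, hblock⟩ := exists_isBlockSet_superset (isBiconnectedOn_cycle hv hve)
  have hcard := (hH.2.2 B hblock).2
  have hle := Set.ncard_le_ncard (s := Set.range e) (t := {f : E | (H.edge f : Set V) ⊆ B})
    (by rintro _ ⟨i, rfl⟩; exact fun w hw => hB ⟨i, hw⟩)
  rw [hcard, Set.ncard_range_of_injective he, Nat.card_fin] at hle
  omega

theorem isClique_edge (H : MultiHypergraph V E) (f : E) :
    H.shadow.IsClique (H.edge f : Set V) :=
  fun _ hu _ hw huw => ⟨huw, f, hu, hw⟩

theorem edge_nontrivial {r : ℕ} (hr : 2 ≤ r) (hH : H.IsUniform r) (f : E) :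
    (H.edge f : Set V).Nontrivial :=
  Finset.one_lt_card_iff_nontrivial.1 (by rw [hH f]; omega)

/-- A hyperedge is a clique of the shadow, so some block contains it, and that block has no more
than `r` vertices. -/
theorem IsBlockTree.isBlockSet_edge [Finite V] {r q : ℕ} (hr : 2 ≤ r)
    (hH : H.IsBlockTree r r q) (f : E) : H.shadow.IsBlockSet (H.edge f : Set V) := by
  obtain ⟨B, hB, hblock⟩ := exists_isBlockSet_superset
    ((H.isClique_edge f).isBiconnectedOn (edge_nontrivial hr hH.1 f))
  have : (H.edge f : Set V) = B := Set.eq_of_subset_of_ncard_le hB (by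
    rw [(hH.2.2 B hblock).1, Set.ncard_coe_finset, hH.1 f])
  rwa [this]

/-- A connected graph whose edges are covered by `d` vertex sets of size at most `r` has at most
`d (r - 1) + 1` vertices. -/
theorem card_le_of_connected_of_cover [Fintype V] {G : SimpleGraph V} (hG : G.Connected)
    {𝓓 : Finset (Finset V)} {r : ℕ} (h𝓓 : ∀ D ∈ 𝓓, D.card ≤ r)
    (hcover : ∀ u w, G.Adj u w → ∃ D ∈ 𝓓, u ∈ D ∧ w ∈ D) :
    Fintype.card V ≤ 𝓓.card * (r - 1) + 1 := by
  classical
  -- A maximal such family has `Y` equal to all vertices: an edge leaving `Y` lies in a further set,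
  -- which adds at most `r - 1` vertices.
  let p : Finset (Finset V) → Prop := fun 𝓒 => 𝓒 ⊆ 𝓓 ∧ ∃ Y : Finset V, Y.Nonempty ∧
    Y.card ≤ 𝓒.card * (r - 1) + 1 ∧ ∀ D ∈ 𝓒, D ⊆ Y
  have hp0 : p ∅ := by
    obtain ⟨x⟩ := hG.nonempty
    exact ⟨Finset.empty_subset _, {x}, Finset.singleton_nonempty x, by simp, by simp⟩
  obtain ⟨𝓒, -, ⟨h𝓒, Y, ⟨y, hy⟩, hYcard, hY⟩, hmax⟩ := Finite.exists_le_maximal hp0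
  have hYuniv : Y = Finset.univ := by
    by_contra hne
    obtain ⟨z, hz⟩ : ∃ z, z ∉ Y := by
      by_contra! hall
      exact hne (Finset.eq_univ_iff_forall.2 hall)
    obtain ⟨u, hu, w, hw, huw⟩ := hG.exists_adj_mem_notMem (A := (Y : Set V)) hy hz
    obtain ⟨D, hD, huD, hwD⟩ := hcover u w huw
    have hD𝓒 : D ∉ 𝓒 := fun h => hw (hY D h hwD)
    refine hD𝓒 (hmax (y := insert D 𝓒) ⟨Finset.insert_subset hD h𝓒, Y ∪ D,
      ⟨u, Finset.mem_union_left _ hu⟩, ?_, ?_⟩ (Finset.subset_insert _ _)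
      (Finset.mem_insert_self _ _))
    · have h1 := Finset.card_union_add_card_inter Y D
      have h2 : 0 < (Y ∩ D).card := Finset.card_pos.2 ⟨u, Finset.mem_inter.2 ⟨hu, huD⟩⟩
      have h3 := h𝓓 D hD
      rw [Finset.card_insert_of_notMem hD𝓒, add_mul, one_mul]
      omega
    · intro D' hD'
      rcases Finset.mem_insert.1 hD' with rfl | hD'
      · exact Finset.subset_union_right
      · exact (hY D' hD').trans Finset.subset_union_left
  rw [← Finset.card_univ, ← hYuniv]
  exact hYcard.trans (by gcongr)

/-- Each vertex set of a hyperedge is a block and so has multiplicity `q`; these sets cover the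
connected shadow, which bounds their number from below. -/
theorem IsBlockTree.le_card [Fintype V] [Fintype E] {r q : ℕ} (hr : 2 ≤ r)
    (hH : H.IsBlockTree r r q) : (Fintype.card V - 1) / (r - 1) * q ≤ Fintype.card E := by
  classical
  have hfiber : ∀ D ∈ Finset.univ.image H.edge,
      (Finset.univ.filter fun f => H.edge f = D).card = q := by
    intro D hD
    obtain ⟨f, -, rfl⟩ := Finset.mem_image.1 hD
    rw [← (hH.2.2 _ (hH.isBlockSet_edge hr f)).2, ← Set.ncard_coe_finset]
    congr 1
    ext g
    simp only [Finset.coe_filter, Finset.mem_univ, true_and, Set.mem_ofPred_eq, Finset.coe_subset]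
    exact ⟨fun h => h.subset, fun h => Finset.eq_of_subset_of_card_le h (by rw [hH.1, hH.1])⟩
  have hcard : Fintype.card E = (Finset.univ.image H.edge).card * q := by
    rw [← Finset.card_univ, Finset.card_eq_sum_card_image H.edge, Finset.sum_congr rfl hfiber,
      Finset.sum_const, smul_eq_mul]
  have hV := card_le_of_connected_of_cover hH.2.1 (𝓓 := Finset.univ.image H.edge) (r := r)
    (fun D hD => by
      obtain ⟨f, -, rfl⟩ := Finset.mem_image.1 hD
      exact (hH.1 f).le)
    (fun u w ⟨_, f, hu, hw⟩ => ⟨_, Finset.mem_image_of_mem _ (Finset.mem_univ f), hu, hw⟩)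
  rw [hcard]
  gcongr
  exact Nat.div_le_of_le_mul (by rw [mul_comm]; omega)

theorem isBlockTree_of_isTreeLike [Fintype V] [Nonempty V] [Fintype E] {k r : ℕ} (hk : 2 ≤ k)
    (hkr : k ≤ r) (hH : H.IsUniform r) (hT : H.IsTreeLike k r Finset.univ Finset.univ) :
    H.IsBlockTree r r (k - 1) := by
  classical
  refine ⟨hH, ⟨fun x y => ?_⟩, fun B hB => ?_⟩
  · by_cases hxy : x = y
    · rw [hxy]
    · obtain ⟨e, v, t, h, -, hx, hxv, rfl⟩ := hT.joined x (Finset.mem_univ _) y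
        (Finset.mem_univ _) hxy
      have : ∀ j < t + 1, H.shadow.Reachable x (v j) := by
        intro j
        induction j with
        | zero =>
          intro hj
          exact SimpleGraph.Adj.reachable
            (⟨(hxv 0 hj).symm, e 0, hx, h.left 0 hj⟩ : H.shadow.Adj x (v 0))
        | succ j ih =>
          intro hj
          refine (ih (by omega)).trans (SimpleGraph.Adj.reachable
            (⟨fun hv => ?_, e (j + 1), h.right j hj, h.left _ hj⟩ : H.shadow.Adj _ _))
          have := h.inj_vert j (by omega) (j + 1) hj hv
          omega
      exact this t (by omega)
  · obtain ⟨D, hBD, hD, hDF⟩ := hT.biconnected B (by simp) (by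
      rw [shadowOn_univ]
      exact hB.1)
    obtain ⟨f, hf⟩ := Finset.card_pos.1 (by rw [hDF]; omega)
    rw [Finset.mem_filter] at hf
    have hfD : H.edge f = D := Finset.eq_of_subset_of_card_le hf.2 (by rw [hD, hH])
    -- `D` is itself a hyperedge, hence a clique, so maximality of the block gives equality.
    have hDB : (D : Set V) ⊆ B := hB.2 (y := (D : Set V)) (by
      rw [← hfD]
      exact (H.isClique_edge f).isBiconnectedOn (edge_nontrivial (by omega) hH f)) hBD
    obtain rfl : B = D := hBD.antisymm hDB
    refine ⟨by rw [Set.ncard_coe_finset, hD], ?_⟩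
    rw [← hDF, ← Set.ncard_coe_finset]
    congr 1
    ext g
    simp

/-! ### Sharpness -/

theorem mem_bergeCycleFreeSizes [Fintype V] {k r : ℕ} (hk : 2 ≤ k) (hkr : k ≤ r) :
    (Fintype.card V - 1) / (r - 1) * (k - 1) ∈ bergeCycleFreeSizes V r k := by
  classical
  set q := (Fintype.card V - 1) / (r - 1)
  let φ : V → ℕ := fun w => Fintype.equivFin V w
  have hφ : Function.Injective φ := Fin.val_injective.comp (Fintype.equivFin V).injective
  -- A sunflower: vertex `0` is the centre, the petals are consecutive runs of `r - 1` vertices, and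
  -- each petal with the centre is taken `k - 1` times.
  let H : MultiHypergraph V (Fin (q * (k - 1))) := ⟨fun i => Finset.univ.filter fun w =>
    φ w = 0 ∨ φ w ≠ 0 ∧ (φ w - 1) / (r - 1) = i / (k - 1)⟩
  have hmem : ∀ w i, w ∈ H.edge i ↔ φ w = 0 ∨ φ w ≠ 0 ∧ (φ w - 1) / (r - 1) = i / (k - 1) :=
    fun w i => by simp [H]
  refine ⟨H, fun i => ?_, ?_⟩
  · have hi : i / (k - 1) < q := Nat.div_lt_of_lt_mul (i.2.trans_eq (mul_comm _ _))
    set p := (i : ℕ) / (k - 1) with hp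
    have hle : (p + 1) * (r - 1) ≤ Fintype.card V - 1 :=
      (Nat.mul_le_mul_right _ hi).trans (Nat.div_mul_le_self _ _)
    rw [add_mul, one_mul] at hle
    have himage : (H.edge i).image φ =
        insert 0 (Finset.Ico (p * (r - 1) + 1) (p * (r - 1) + 1 + (r - 1))) := by
      have hdiv : ∀ m, (m - 1) / (r - 1) = p ↔
          p * (r - 1) ≤ m - 1 ∧ m - 1 < p * (r - 1) + (r - 1) := by
        intro m
        rw [Nat.div_eq_iff (by omega)]
        omega
      ext m
      simp only [Finset.mem_image, Finset.mem_insert, Finset.mem_Ico, hmem, ← hp, hdiv]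
      constructor
      · rintro ⟨w, hw, rfl⟩
        omega
      · intro hm
        refine ⟨(Fintype.equivFin V).symm ⟨m, by omega⟩, ?_⟩
        simp only [φ, Equiv.apply_symm_apply, and_true]
        omega
    rw [← Finset.card_image_of_injective _ hφ, himage, Finset.card_insert_of_notMem (by simp)]
    simp
    omega
  · rintro t ht ⟨v, e, hv, he, hve⟩
    obtain ⟨n, rfl⟩ : ∃ n, t = n + 2 := ⟨t - 2, by omega⟩
    simp only [finRotate_apply, hmem] at hve
    have huniq : ∀ i j, ¬ φ (v i) ≠ 0 → ¬ φ (v j) ≠ 0 → i = j := fun i j hi hj =>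
      hv (hφ (by rw [not_not.1 hi, not_not.1 hj]))
    have hconst : ∀ i j, φ (v i) ≠ 0 → φ (v j) ≠ 0 →
        (φ (v i) - 1) / (r - 1) = (φ (v j) - 1) / (r - 1) := fun i j hi hj =>
      Fin.eq_of_forall_eq_add_one (P := fun i => φ (v i) ≠ 0)
        (f := fun i => (φ (v i) - 1) / (r - 1)) huniq
        (fun i hi hi' => ((hve i).1.resolve_left hi).2.trans
          ((hve i).2.resolve_left hi').2.symm) hi hj
    -- The centre occurs at most once on the cycle, so every hyperedge of the cycle has a
    -- non-central cycle vertex that identifies its petal.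
    have hex : ∀ i, ∃ j, φ (v j) ≠ 0 ∧ (φ (v j) - 1) / (r - 1) = e i / (k - 1) := by
      intro i
      rcases (hve i).1 with h0 | h0
      · rcases (hve i).2 with h1 | h1
        · exact absurd (huniq (i + 1) i (not_not.2 h1) (not_not.2 h0)) (Fin.add_one_ne_self i)
        · exact ⟨_, h1⟩
      · exact ⟨_, h0⟩
    obtain ⟨j, hj, hj'⟩ := hex 0
    have hp : ∀ i, (e i : ℕ) / (k - 1) = e 0 / (k - 1) := by
      intro i
      obtain ⟨l, hl, hl'⟩ := hex i
      rw [← hl', ← hj']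
      exact hconst l j hl hj
    -- Within one petal, hyperedges are told apart by their label modulo `k - 1`.
    have hcard := Finset.card_le_card_of_injOn (s := (Finset.univ : Finset (Fin (n + 2))))
      (t := Finset.range (k - 1)) (fun i => (e i : ℕ) % (k - 1))
      (fun i _ => by simpa using Nat.mod_lt _ (by omega))
      (fun i _ j _ hij => he (Fin.ext (by
        rw [← Nat.div_add_mod (e i : ℕ) (k - 1), ← Nat.div_add_mod (e j : ℕ) (k - 1), hp i, hp j]
        exact congrArg _ hij)))
    rw [Finset.card_univ, Fintype.card_fin, Finset.card_range] at hcard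
    omega

theorem card_edges_le [Fintype V] [Nonempty V] [Fintype E] {k r : ℕ} (hk : 2 ≤ k) (hkr : k ≤ r)
    (hH : H.IsUniform r) (hfree : H.BergeCycleFree k) :
    Fintype.card E ≤ (Fintype.card V - 1) / (r - 1) * (k - 1) := by
  simpa using card_le_of_bergeCycleFree hk hkr hH hfree Finset.univ Finset.univ
    Finset.univ_nonempty fun f _ => Finset.subset_univ _

end MultiHypergraph

theorem mainTheorem3 {V : Type*} [Fintype V] (k n r : ℕ)
    (hk : 2 ≤ k) (hkr : k ≤ r) (hn : 1 ≤ n) (hV : Fintype.card V = n) :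
    IsGreatest (MultiHypergraph.bergeCycleFreeSizes V r k) ((n - 1) / (r - 1) * (k - 1)) ∧
    ((r - 1) ∣ (n - 1) →
      ∀ {E : Type*} [Fintype E] (H : MultiHypergraph V E),
        H.IsExtremal r k ↔ H.IsBlockTree r r (k - 1)) := by
  subst hV
  have : Nonempty V := Fintype.card_pos_iff.1 hn
  have hgreatest : IsGreatest (MultiHypergraph.bergeCycleFreeSizes V r k)
      ((Fintype.card V - 1) / (r - 1) * (k - 1)) := by
    refine ⟨MultiHypergraph.mem_bergeCycleFreeSizes hk hkr, ?_⟩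
    rintro m ⟨H, hH, hfree⟩
    simpa using MultiHypergraph.card_edges_le hk hkr hH hfree
  refine ⟨hgreatest, fun hdvd E _ H => ⟨fun ⟨hH, hfree, hmax⟩ => ?_, fun hH => ?_⟩⟩
  · refine MultiHypergraph.isBlockTree_of_isTreeLike hk hkr hH
      (MultiHypergraph.isTreeLike_of_card_eq hk hkr hH hfree
        ((Fintype.card V - 1) / (r - 1)) _ _ ?_ (fun f _ => Finset.subset_univ _) ?_)
    · rw [Nat.div_mul_cancel hdvd, Finset.card_univ]
      omega
    · rw [Finset.card_univ]
      exact (MultiHypergraph.card_edges_le hk hkr hH hfree).antisymm (hmax _ hgreatest.1)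
  · exact ⟨hH.1, hH.bergeCycleFree hk, fun m hm =>
      (hgreatest.2 hm).trans (hH.le_card (by omega))⟩
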